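/- Let $K\ge 0$, let $\mathcal H_1,\dots,\mathcal H_K$ be finite-dimensional complex Hilbert spaces, each identified with a coordinate space $\mathbb C^{d_j}$ by an orthonormal basis, and let $\mathcal H=\mathcal H_1\otimes\cdots\otimes\mathcal H_K$. For $\pi\in\mathfrak S_4$ let $U_\pi$ be the unitary on the fourth tensor power of a space given by $U_\pi\,(v_1\otimes v_2\otimes v_3\otimes v_4)=v_{\pi^{-1}(1)}\otimes v_{\pi^{-1}(2)}\otimes v_{\pi^{-1}(3)}\otimes v_{\pi^{-1}(4)}$. For $\underline\pi=(\pi_1,\dots,\pi_K)\in\mathfrak S_4^K$ let $U_{\underline\pi}=U_{\pi_1}\otimes\cdots\otimes U_{\pi_K}$, where $U_{\pi_j}$ acts on $\mathcal H_j^{\otimes 4}$, regarded as an operator on $\mathcal H^{\otimes 4}\cong\mathcal H_1^{\otimes 4}\otimes\cdots\otimes\mathcal H_K^{\otimes 4}$. For $I\subseteq[K]=\{1,\dots,K\}$ let $\operatorname{tr}_I$ denote the partial trace over the factors $\mathcal H_j$, $j\in I$. Then for every Hermitian operator $\Delta$ on $\mathcal H$, \[ \operatorname{tr}\Bigl(\Delta^{\otimes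 4}\sum_{\underline\pi\in\mathfrak S_4^K}U_{\underline\pi}\Bigr)\;\le\;18^K\Bigl[\sum_{I\subseteq[K]}\operatorname{tr}\bigl((\operatorname{tr}_I\Delta)^2\bigr)\Bigr]^2 , \] where both sides are real. -/

import Mathlib

open scoped ComplexOrder

/-- The tensor product `A₁ ⊗ ⋯ ⊗ A_K` of operators `A_j` on `ℂ^{κ_j}`, an operator on
`ℂ^{κ_1} ⊗ ⋯ ⊗ ℂ^{κ_K} = ℂ^{κ_1 × ⋯ × κ_K}`; it is given by its matrix in the product basis. -/
def tensorOp {J : Type*} [Fintype J] {κ : J → Type*} (A : ∀ j, Matrix (κ j) (κ j) ℂ) :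
    Matrix (∀ j, κ j) (∀ j, κ j) ℂ :=
  Matrix.of fun x y => ∏ j, A j (x j) (y j)

/-- The `t`-fold tensor power `A^{⊗t}`. -/
def tensorPow (t : ℕ) {X : Type*} (A : Matrix X X ℂ) : Matrix (Fin t → X) (Fin t → X) ℂ :=
  tensorOp fun _ : Fin t => A

/-- The permutation unitary `U_π` on `(ℂ^X)^{⊗t}`, that is
`U_π |y_1⟩⊗⋯⊗|y_t⟩ = |y_{π⁻¹(1)}⟩⊗⋯⊗|y_{π⁻¹(t)}⟩`. -/
def permOp {t : ℕ} {X : Type*} [DecidableEq X] (π : Equiv.Perm (Fin t)) :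
    Matrix (Fin t → X) (Fin t → X) ℂ :=
  Matrix.of fun x y => if x = fun q => y (π⁻¹ q) then 1 else 0

/-- The operator `U_{π_1} ⊗ ⋯ ⊗ U_{π_K}`, where `U_{π_j}` permutes the `t` copies of the `j`-th
factor. It lives on `⨂_j (ℂ^{ι_j})^{⊗t}`, which is identified with `(⨂_j ℂ^{ι_j})^{⊗t}` by the
canonical reordering of the tensor factors. -/
def multiPermOp {t K : ℕ} {ι : Fin K → Type*} [∀ j, DecidableEq (ι j)]
    (π : Fin K → Equiv.Perm (Fin t)) :
    Matrix (Fin t → ∀ j, ι j) (Fin t → ∀ j, ι j) ℂ :=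
  Matrix.reindex (Equiv.piComm fun (j : Fin K) (_ : Fin t) => ι j)
    (Equiv.piComm fun (j : Fin K) (_ : Fin t) => ι j)
    (tensorOp fun j => permOp (X := ι j) (π j))

/-- The partial trace `tr_I` over the factors `j ∈ I` of `⨂_j ℂ^{ι_j}`; the result is an operator
on the tensor product of the remaining factors. -/
def partialTrace {K : ℕ} {ι : Fin K → Type*} [∀ j, Fintype (ι j)] (I : Finset (Fin K))
    (A : Matrix (∀ j, ι j) (∀ j, ι j) ℂ) :
    Matrix (∀ j : {j // j ∉ I}, ι j) (∀ j : {j // j ∉ I}, ι j) ℂ :=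
  Matrix.of fun x y => ∑ z : ∀ j : {j // j ∈ I}, ι j,
    A ((Equiv.piEquivPiSubtypeProd (· ∈ I) ι).symm (z, x))
      ((Equiv.piEquivPiSubtypeProd (· ∈ I) ι).symm (z, y))

/-! For fixed `π` the trace is a tensor network on four copies of `Δ`, where factor `j` joins copy
`q` to copy `π j q`. Contracting the loops turns copy `q` into the partial trace of `Δ` over
`fixedFactors π q`. Every remaining edge joins two distinct copies, so Cauchy–Schwarz, applied edge
by edge, bounds the network by the product of Hilbert–Schmidt norms (`norm_sum_prod_le`). AM–GM
splits this product into pairs of copies, and counting permutations with prescribed fixed points at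
two copies gives the constant `14 ^ K`, better than needed (`sum_prod_sqrt_fixedFactors_le`). -/

/-! ### Cauchy–Schwarz on graphs -/

section GeneralizedCauchySchwarz

open MeasureTheory Finset
open scoped ENNReal

variable {E V : Type*} [DecidableEq E] [Fintype V] [DecidableEq V]
  {α : E → Type*} [∀ e, MeasurableSpace (α e)]

/-- Generalized Cauchy–Schwarz inequality for a loop-free graph with vertices `V` and edges `E`:
every edge variable is shared by exactly two of the functions. -/
theorem lmarginal_prod_le_of_graph (μ : ∀ e, Measure (α e)) [∀ e, SigmaFinite (μ e)]
    (a b : E → V) (hab : ∀ e, a e ≠ b e) (f : V → (∀ e, α e) → ℝ≥0∞)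
    (hf : ∀ v, Measurable (f v))
    (hdep : ∀ v e, a e ≠ v → b e ≠ v → ∀ x y, f v (Function.update x e y) = f v x)
    (s : Finset E) (x : ∀ e, α e) :
    lmarginal μ s (fun x => ∏ v, f v x) x ≤
      ∏ v, (lmarginal μ {e ∈ s | a e = v ∨ b e = v} (fun x => f v x ^ (2 : ℝ)) x) ^
        (1 / 2 : ℝ) := by
  induction s using Finset.induction generalizing x with
  | empty =>
    simp only [lmarginal_empty, filter_empty]
    refine le_of_eq (prod_congr rfl fun v _ => ?_)
    rw [← ENNReal.rpow_mul]; norm_num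
  | insert e s he ih =>
    have hm : ∀ v, Measurable fun x => f v x ^ (2 : ℝ) := fun v => (hf v).pow_const _
    rw [lmarginal_insert _ (Finset.measurable_prod _ fun v _ => hf v) he]
    refine (lintegral_mono fun y => ih _).trans ?_
    -- Only the two endpoints of the new edge `e` depend on its variable; the other factors leave
    -- the integral.
    set g : V → (∀ e, α e) → ℝ≥0∞ := fun v x =>
      (lmarginal μ {e ∈ s | a e = v ∨ b e = v} (fun x => f v x ^ (2 : ℝ)) x) ^ (1 / 2 : ℝ)
      with hg
    have hgm : ∀ v, Measurable fun y => g v (Function.update x e y) := fun v =>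
      (((hm v).lmarginal μ).comp (measurable_update x)).pow_const _
    have hrest : ∀ v, v ≠ a e → v ≠ b e → ∀ y, g v (Function.update x e y) = g v x := by
      intro v hva hvb y
      simp only [hg]
      rw [lmarginal_update_of_notMem (hm v) (by simp [he])]
      congr 2
      funext z
      simp [hdep v e hva.symm hvb.symm]
    have hedge : ∀ v, (a e = v ∨ b e = v) →
        (∫⁻ y, g v (Function.update x e y) ^ (2 : ℝ) ∂μ e) ^ (1 / 2 : ℝ) =
        (lmarginal μ {e' ∈ insert e s | a e' = v ∨ b e' = v} (fun x => f v x ^ (2 : ℝ)) x) ^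
        (1 / 2 : ℝ) := by
      intro v hv
      rw [filter_insert, if_pos hv, lmarginal_insert _ (hm v) (by simp [he])]
      congr 1
      refine lintegral_congr fun y => ?_
      simp only [hg]
      rw [← ENNReal.rpow_mul]; norm_num
    have hsplit : ∀ h : V → ℝ≥0∞, ∏ v, h v =
        (h (a e) * h (b e)) * ∏ v ∈ (univ.erase (a e)).erase (b e), h v := by
      intro h
      rw [← mul_prod_erase univ h (mem_univ (a e)),
        ← mul_prod_erase (univ.erase (a e)) h (a := b e) (by simp [(hab e).symm]), mul_assoc]
    have hint : ∀ y, ∏ v, g v (Function.update x e y) =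
        (g (a e) (Function.update x e y) * g (b e) (Function.update x e y)) *
          ∏ v ∈ (univ.erase (a e)).erase (b e), g v x := by
      intro y
      rw [hsplit]
      congr 1
      refine prod_congr rfl fun v hv => hrest v ?_ ?_ y
      · simp only [mem_erase] at hv; exact hv.2.1
      · simp only [mem_erase] at hv; exact hv.1
    change ∫⁻ y, ∏ v, g v (Function.update x e y) ∂μ e ≤ _
    simp_rw [hint]
    have hpair : Measurable fun y =>
        g (a e) (Function.update x e y) * g (b e) (Function.update x e y) :=
      (hgm _).mul (hgm _)
    rw [lintegral_mul_const _ hpair, hsplit]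
    refine mul_le_mul' ?_ (le_of_eq (prod_congr rfl fun v hv => ?_))
    · rw [← hedge _ (Or.inl rfl), ← hedge _ (Or.inr rfl)]
      exact ENNReal.lintegral_mul_le_Lp_mul_Lq (μ e) Real.HolderConjugate.two_two
        (hgm _).aemeasurable (hgm _).aemeasurable
    · simp only [mem_erase] at hv
      simp only [hg]
      rw [filter_insert, if_neg]
      rintro (h | h)
      · exact hv.2.1 h.symm
      · exact hv.1 h.symm

theorem lintegral_pi_count {E : Type*} [Fintype E] {α : E → Type*} [∀ e, Fintype (α e)]
    [DecidableEq E] [∀ e, MeasurableSpace (α e)] [∀ e, MeasurableSingletonClass (α e)]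
    (f : (∀ e, α e) → ℝ≥0∞) :
    ∫⁻ x, f x ∂(Measure.pi fun e => (Measure.count : Measure (α e))) = ∑ x, f x := by
  rw [lintegral_fintype]
  simp [Measure.pi_singleton]

/-- Finite form of the generalized Cauchy–Schwarz inequality. -/
theorem sum_prod_le_of_graph [Fintype E] [∀ e, Fintype (α e)]
    [∀ e, MeasurableSingletonClass (α e)]
    (a b : E → V) (hab : ∀ e, a e ≠ b e) (f : V → (∀ e, α e) → ℝ≥0∞)
    (hdep : ∀ v e, a e ≠ v → b e ≠ v → ∀ x y, f v (Function.update x e y) = f v x)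
    (x : ∀ e, α e) :
    ∑ x, ∏ v, f v x ≤ ∏ v, (∑ y : ∀ e : ({e | a e = v ∨ b e = v} : Finset E), α e,
      f v (Function.updateFinset x _ y) ^ (2 : ℝ)) ^ (1 / 2 : ℝ) := by
  have h := lmarginal_prod_le_of_graph (fun e => (Measure.count : Measure (α e))) a b hab f
    (fun v => measurable_of_finite _) hdep univ x
  rw [lmarginal_univ] at h
  simpa only [lmarginal, lintegral_pi_count] using h

end GeneralizedCauchySchwarz

/-! ### Traces as tensor networks -/

open scoped ENNReal

theorem multiPermOp_apply {t K : ℕ} {ι : Fin K → Type*} [∀ j, DecidableEq (ι j)]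
    (π : Fin K → Equiv.Perm (Fin t)) (x y : Fin t → ∀ j, ι j) :
    multiPermOp π x y = if x = fun q j => y ((π j)⁻¹ q) j then 1 else 0 := by
  have h : multiPermOp π x y = ∏ j, if (fun q => x q j) = fun q => y ((π j)⁻¹ q) j
      then (1 : ℂ) else 0 := rfl
  rw [h]
  split_ifs with hx
  · refine Finset.prod_eq_one fun j _ => if_pos ?_
    funext q
    rw [hx]
  · obtain ⟨j, hj⟩ : ∃ j, ¬ (fun q => x q j) = fun q => y ((π j)⁻¹ q) j := by
      by_contra! hc
      exact hx (funext fun q => funext fun j => congrFun (hc j) q)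
    exact Finset.prod_eq_zero (Finset.mem_univ j) (if_neg hj)

theorem trace_tensorPow_mul_multiPermOp {t K : ℕ} {ι : Fin K → Type*} [∀ j, Fintype (ι j)]
    [∀ j, DecidableEq (ι j)] (Δ : Matrix (∀ j, ι j) (∀ j, ι j) ℂ)
    (π : Fin K → Equiv.Perm (Fin t)) :
    (tensorPow t Δ * multiPermOp π).trace =
      ∑ x : Fin t → ∀ j, ι j, ∏ q, Δ (x q) fun j => x ((π j)⁻¹ q) j := by
  simp only [Matrix.trace, Matrix.diag_apply, Matrix.mul_apply, multiPermOp_apply, mul_ite,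
    mul_one, mul_zero, Finset.sum_ite_eq', Finset.mem_univ, if_true]
  rfl

/-- The squared Hilbert–Schmidt norm of the partial trace over the factors in `I`. -/
noncomputable def partialTraceNormSq {K : ℕ} {ι : Fin K → Type*} [∀ j, Fintype (ι j)]
    (I : Finset (Fin K)) (A : Matrix (∀ j, ι j) (∀ j, ι j) ℂ) : ℝ :=
  ∑ x, ∑ y, ‖partialTrace I A x y‖ ^ 2

theorem partialTraceNormSq_nonneg {K : ℕ} {ι : Fin K → Type*} [∀ j, Fintype (ι j)]
    (I : Finset (Fin K)) (A : Matrix (∀ j, ι j) (∀ j, ι j) ℂ) : 0 ≤ partialTraceNormSq I A :=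
  Finset.sum_nonneg fun _ _ => Finset.sum_nonneg fun _ _ => by positivity

theorem isHermitian_partialTrace {K : ℕ} {ι : Fin K → Type*} [∀ j, Fintype (ι j)]
    (I : Finset (Fin K)) {A : Matrix (∀ j, ι j) (∀ j, ι j) ℂ} (hA : A.IsHermitian) :
    (partialTrace I A).IsHermitian := by
  ext x y
  rw [Matrix.conjTranspose_apply]
  simp only [partialTrace, Matrix.of_apply, star_sum]
  exact Finset.sum_congr rfl fun z _ => hA.apply _ _

theorem trace_partialTrace_sq {K : ℕ} {ι : Fin K → Type*} [∀ j, Fintype (ι j)]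
    [∀ j, DecidableEq (ι j)]
    (I : Finset (Fin K)) {A : Matrix (∀ j, ι j) (∀ j, ι j) ℂ} (hA : A.IsHermitian) :
    (partialTrace I A ^ 2).trace = (partialTraceNormSq I A : ℂ) := by
  simp only [partialTraceNormSq, Matrix.trace, Matrix.diag_apply, sq (partialTrace I A),
    Matrix.mul_apply, Complex.ofReal_sum]
  refine Finset.sum_congr rfl fun x _ => Finset.sum_congr rfl fun y _ => ?_
  rw [← (isHermitian_partialTrace I hA).apply y x]
  push_cast
  exact Complex.mul_conj' _

/-! ### Bound for a single tuple of permutations -/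

section Bound

variable {t K : ℕ} {ι : Fin K → Type*} [∀ j, Fintype (ι j)]

/-- The factors on which the copy `q` is fixed. -/
def fixedFactors (π : Fin K → Equiv.Perm (Fin t)) (q : Fin t) : Finset (Fin K) :=
  {j | π j q = q}

theorem inv_apply_notMem_fixedFactors (π : Fin K → Equiv.Perm (Fin t)) {q : Fin t} {j : Fin K}
    (h : j ∉ fixedFactors π q) : j ∉ fixedFactors π ((π j)⁻¹ q) := by
  simp only [fixedFactors, Finset.mem_filter, Finset.mem_univ, true_and] at h ⊢
  intro h'
  apply h
  have h2 : q = (π j)⁻¹ q := by simpa using h'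
  exact (Equiv.Perm.eq_inv_iff_eq.1 h2)

/-- The column index, at copy `q`, of the tensor network left after contracting all loops. -/
def shiftedIndex (π : Fin K → Equiv.Perm (Fin t))
    (w : ∀ q, ∀ j : {j // j ∉ fixedFactors π q}, ι j) (q : Fin t) :
    ∀ j : {j // j ∉ fixedFactors π q}, ι j :=
  fun j => w ((π j)⁻¹ q) ⟨j, inv_apply_notMem_fixedFactors π j.2⟩

/-- If `π j` fixes `q`, the variable `x q j` is both row and column index of copy `q` and occurs in
no other copy, so it can be summed inside that factor. -/
theorem sum_prod_eq_sum_prod_partialTrace (Δ : Matrix (∀ j, ι j) (∀ j, ι j) ℂ)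
    (π : Fin K → Equiv.Perm (Fin t)) :
    ∑ x : Fin t → ∀ j, ι j, ∏ q, Δ (x q) (fun j => x ((π j)⁻¹ q) j) =
      ∑ w : ∀ q, ∀ j : {j // j ∉ fixedFactors π q}, ι j,
        ∏ q, partialTrace (fixedFactors π q) Δ (w q) (shiftedIndex π w q) := by
  let e : (Fin t → ∀ j, ι j) ≃ (∀ q, ∀ j : {j // j ∈ fixedFactors π q}, ι j) ×
      (∀ q, ∀ j : {j // j ∉ fixedFactors π q}, ι j) :=
    { toFun x := (fun q j => x q j, fun q j => x q j)
      invFun p q := (Equiv.piEquivPiSubtypeProd (· ∈ fixedFactors π q) ι).symm (p.1 q, p.2 q)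
      left_inv x := by
        funext q
        exact (Equiv.piEquivPiSubtypeProd (· ∈ fixedFactors π q) ι).left_inv (x q)
      right_inv p := by
        refine Prod.ext (funext fun q => ?_) (funext fun q => ?_)
        · exact congrArg Prod.fst
            ((Equiv.piEquivPiSubtypeProd (· ∈ fixedFactors π q) ι).right_inv (p.1 q, p.2 q))
        · exact congrArg Prod.snd
            ((Equiv.piEquivPiSubtypeProd (· ∈ fixedFactors π q) ι).right_inv (p.1 q, p.2 q)) }
  rw [← e.symm.sum_comp, Fintype.sum_prod_type_right]
  refine Finset.sum_congr rfl fun w _ => ?_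
  simp only [partialTrace, Matrix.of_apply]
  rw [Fintype.prod_sum]
  refine Finset.sum_congr rfl fun z _ => Finset.prod_congr rfl fun q _ => ?_
  congr 1
  funext j
  by_cases hj : j ∈ fixedFactors π q
  · have hq : (π j)⁻¹ q = q := by
      rw [Equiv.Perm.inv_eq_iff_eq]
      exact (by simpa [fixedFactors] using hj : π j q = q).symm
    rw [hq]
    simp [e, Equiv.piEquivPiSubtypeProd, hj]
  · have hj' := inv_apply_notMem_fixedFactors π hj
    simp only [e, Equiv.piEquivPiSubtypeProd, Equiv.coe_fn_symm_mk, hj, hj', shiftedIndex,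
      dite_false]

/-- Index assignments for the edges that are not loops, as families over the copies. -/
def curryNonfixed (π : Fin K → Equiv.Perm (Fin t)) :
    (∀ e : Σ q, {j // j ∉ fixedFactors π q}, ι e.2) ≃
      ∀ q, ∀ j : {j // j ∉ fixedFactors π q}, ι j :=
  Equiv.piCurry fun q (j : {j // j ∉ fixedFactors π q}) => ι j

theorem enorm_sum_prod_le (Δ : Matrix (∀ j, ι j) (∀ j, ι j) ℂ)
    (π : Fin K → Equiv.Perm (Fin t)) :
    ‖∑ x : Fin t → ∀ j, ι j, ∏ q, Δ (x q) (fun j => x ((π j)⁻¹ q) j)‖ₑ ≤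
      ∏ q, (ENNReal.ofReal (partialTraceNormSq (fixedFactors π q) Δ)) ^ (1 / 2 : ℝ) := by
  classical
  rw [sum_prod_eq_sum_prod_partialTrace]
  -- A base point `w₀` is needed to fill in the edges not incident to a given copy.
  rcases isEmpty_or_nonempty (∀ q, ∀ j : {j // j ∉ fixedFactors π q}, ι j) with hE | ⟨⟨w₀⟩⟩
  · simp
  let E := Σ q, {j // j ∉ fixedFactors π q}
  let α : E → Type _ := fun e => ι e.2
  let _ : ∀ e, MeasurableSpace (α e) := fun _ => ⊤
  have _ : ∀ e, MeasurableSingletonClass (α e) := fun _ => ⟨fun _ => trivial⟩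
  let f : Fin t → (∀ e, α e) → ℝ≥0∞ := fun q w =>
    ‖partialTrace (fixedFactors π q) Δ (curryNonfixed π w q)
      (shiftedIndex π (curryNonfixed π w) q)‖ₑ
  have hne : ∀ e : E, e.1 ≠ π e.2 e.1 := fun e h => e.2.2 (by simp [fixedFactors, ← h])
  have key := sum_prod_le_of_graph (fun e : E => e.1) (fun e : E => π e.2 e.1) hne f ?_
    ((curryNonfixed π).symm w₀)
  · calc _ ≤ ∑ w : ∀ q, ∀ j : {j // j ∉ fixedFactors π q}, ι j,
        ∏ q, ‖partialTrace (fixedFactors π q) Δ (w q) (shiftedIndex π w q)‖ₑ := by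
          refine (enorm_sum_le _ _).trans (le_of_eq (Finset.sum_congr rfl fun w _ => ?_))
          simp [enorm_eq_nnnorm, nnnorm_prod]
      _ = ∑ w, ∏ q, f q w := ((curryNonfixed π).sum_comp _).symm
      _ ≤ _ := key
      _ ≤ _ := by
        refine Finset.prod_le_prod' fun q _ => ENNReal.rpow_le_rpow ?_ (by norm_num)
        set S : Finset E := {e | e.1 = q ∨ π e.2 e.1 = q} with hS
        let φ : (∀ e : S, α e) → (∀ j : {j // j ∉ fixedFactors π q}, ι j) ×
            (∀ j : {j // j ∉ fixedFactors π q}, ι j) := fun y =>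
          let w := curryNonfixed π
            (Function.updateFinset ((curryNonfixed π).symm w₀) S y)
          (w q, shiftedIndex π w q)
        -- An edge at `q` is either a row index (it starts at `q`) or a column index (it ends at
        -- `q`) of that copy. Injectivity suffices, since the summands are nonnegative.
        have hφ : Function.Injective φ := by
          intro y y' h
          funext ⟨⟨p, j, hj⟩, he⟩
          have he' := he
          simp only [hS, Finset.mem_filter, Finset.mem_univ, true_and] at he'
          rcases he' with rfl | h2
          · have := congrFun (congrArg Prod.fst h) ⟨j, hj⟩
            simpa [φ, curryNonfixed, Equiv.piCurry, Sigma.curry, Function.updateFinset, he] using this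
          · have hp : (π j).symm q = p := by rw [← h2, Equiv.symm_apply_apply]
            subst hp
            have hj' : j ∉ fixedFactors π q := by
              intro hm
              apply hj
              have : π j q = q := by simpa [fixedFactors] using hm
              have hi : (π j).symm q = q := by rw [Equiv.symm_apply_eq, this]
              rw [hi]; exact hm
            have := congrFun (congrArg Prod.snd h) ⟨j, hj'⟩
            simpa [φ, shiftedIndex, curryNonfixed, Equiv.piCurry, Sigma.curry, Function.updateFinset, he]
              using this
        let G : (∀ j : {j // j ∉ fixedFactors π q}, ι j) ×
            (∀ j : {j // j ∉ fixedFactors π q}, ι j) → ℝ≥0∞ := fun p =>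
          ‖partialTrace (fixedFactors π q) Δ p.1 p.2‖ₑ ^ (2 : ℝ)
        calc _ = ∑ y, G (φ y) := rfl
          _ ≤ ∑ p, G p := by
            rw [← tsum_fintype (L := .unconditional _), ← tsum_fintype (L := .unconditional _)]
            exact ENNReal.tsum_comp_le_tsum_of_injective hφ G
          _ = _ := by
            rw [partialTraceNormSq, Fintype.sum_prod_type, ENNReal.ofReal_sum_of_nonneg
              fun _ _ => Finset.sum_nonneg fun _ _ => by positivity]
            refine Finset.sum_congr rfl fun x _ => ?_
            rw [ENNReal.ofReal_sum_of_nonneg fun _ _ => by positivity]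
            refine Finset.sum_congr rfl fun y _ => ?_
            simp only [G]
            rw [ENNReal.ofReal_pow (norm_nonneg _), ofReal_norm]
            norm_cast
  · rintro q ⟨p, j, hj⟩ h1 h2 x y
    have hw : ∀ (r : Fin t) (i : {i // i ∉ fixedFactors π r}), r = q ∨ π i r = q →
        Function.update x (⟨p, j, hj⟩ : E) y ⟨r, i⟩ = x ⟨r, i⟩ := by
      intro r i hr
      refine Function.update_of_ne ?_ _ _
      rintro h
      obtain ⟨rfl, h⟩ := Sigma.mk.inj_iff.1 h
      obtain rfl := eq_of_heq h
      exact hr.elim h1 h2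
    have e1 : curryNonfixed π (Function.update x (⟨p, j, hj⟩ : E) y) q =
        curryNonfixed π x q := by
      funext i
      exact hw q i (Or.inl rfl)
    have e2 : shiftedIndex π (curryNonfixed π
        (Function.update x (⟨p, j, hj⟩ : E) y)) q =
        shiftedIndex π (curryNonfixed π x) q := by
      funext i
      exact hw _ ⟨i, _⟩ (Or.inr (by simp))
    simp only [f]
    rw [e1, e2]

theorem norm_sum_prod_le (Δ : Matrix (∀ j, ι j) (∀ j, ι j) ℂ)
    (π : Fin K → Equiv.Perm (Fin t)) :
    ‖∑ x : Fin t → ∀ j, ι j, ∏ q, Δ (x q) (fun j => x ((π j)⁻¹ q) j)‖ ≤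
      ∏ q, √(partialTraceNormSq (fixedFactors π q) Δ) := by
  have h := enorm_sum_prod_le Δ π
  have h2 : ∀ q, ENNReal.ofReal (partialTraceNormSq (fixedFactors π q) Δ) ^ (1 / 2 : ℝ) =
      ENNReal.ofReal √(partialTraceNormSq (fixedFactors π q) Δ) := fun q => by
    rw [ENNReal.ofReal_rpow_of_nonneg (partialTraceNormSq_nonneg _ _) (by norm_num),
      Real.sqrt_eq_rpow]
  simp_rw [h2] at h
  rw [← ENNReal.ofReal_prod_of_nonneg fun _ _ => Real.sqrt_nonneg _, ← ofReal_norm] at h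
  exact (ENNReal.ofReal_le_ofReal_iff (Finset.prod_nonneg fun _ _ => Real.sqrt_nonneg _)).1 h

end Bound

/-! ### Counting fixed-point patterns -/

section Counting

open Finset

/-- Of the 24 permutations, 2 fix both points, 4 fix only the first, 4 only the second, and 14 fix
neither. -/
theorem card_perm_fixed_pattern_le (p q : Bool) :
    #{σ : Equiv.Perm (Fin 4) | decide (σ 0 = 0) = p ∧ decide (σ 1 = 1) = q} ≤ 14 ∧
    #{σ : Equiv.Perm (Fin 4) | decide (σ 2 = 2) = p ∧ decide (σ 3 = 3) = q} ≤ 14 := by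
  revert p q; decide

theorem sum_mul_fixedFactors_le {K : ℕ} (a b : Fin 4)
    (hab : ∀ p q : Bool,
      #{σ : Equiv.Perm (Fin 4) | decide (σ a = a) = p ∧ decide (σ b = b) = q} ≤ 14)
    (S : Finset (Fin K) → ℝ) (hS : ∀ I, 0 ≤ S I) :
    ∑ π : Fin K → Equiv.Perm (Fin 4), S (fixedFactors π a) * S (fixedFactors π b) ≤
      14 ^ K * (∑ I, S I) ^ 2 := by
  rw [← Finset.sum_fiberwise_of_maps_to (s := univ) (t := univ)
    (g := fun π : Fin K → Equiv.Perm (Fin 4) => (fixedFactors π a, fixedFactors π b))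
    fun _ _ => mem_univ _, sq, Fintype.sum_mul_sum, Fintype.sum_prod_type, mul_sum]
  refine sum_le_sum fun A _ => ?_
  rw [mul_sum]
  refine sum_le_sum fun B _ => ?_
  have hconst : ∑ π with (fixedFactors π a, fixedFactors π b) = (A, B),
      S (fixedFactors π a) * S (fixedFactors π b) =
      #{π : Fin K → Equiv.Perm (Fin 4) | (fixedFactors π a, fixedFactors π b) = (A, B)} *
        (S A * S B) := by
    rw [← nsmul_eq_mul, ← sum_const]
    refine sum_congr rfl fun π hπ => ?_
    obtain ⟨h1, h2⟩ := Prod.mk.inj (mem_filter.1 hπ).2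
    rw [h1, h2]
  rw [hconst]
  refine mul_le_mul_of_nonneg_right ?_ (mul_nonneg (hS A) (hS B))
  -- Prescribing both fixed sets is a separate condition on each `π j`, so the count is at most a
  -- product over `j`.
  have hsub : ({π : Fin K → Equiv.Perm (Fin 4) |
      (fixedFactors π a, fixedFactors π b) = (A, B)} : Finset _) ⊆
      Fintype.piFinset fun j => {σ : Equiv.Perm (Fin 4) |
        decide (σ a = a) = decide (j ∈ A) ∧ decide (σ b = b) = decide (j ∈ B)} := by
    intro π hπ
    obtain ⟨h1, h2⟩ := Prod.mk.inj (mem_filter.1 hπ).2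
    subst h1 h2
    simp [fixedFactors]
  have hcard := (card_le_card hsub).trans_eq (Fintype.card_piFinset _)
  have hpow := hcard.trans (prod_le_pow_card _ _ 14 fun j _ => hab _ _)
  rw [card_univ, Fintype.card_fin] at hpow
  exact_mod_cast hpow

theorem sum_prod_sqrt_fixedFactors_le {K : ℕ} (S : Finset (Fin K) → ℝ) (hS : ∀ I, 0 ≤ S I) :
    ∑ π : Fin K → Equiv.Perm (Fin 4), ∏ q, √(S (fixedFactors π q)) ≤
      14 ^ K * (∑ I, S I) ^ 2 := by
  have h01 := sum_mul_fixedFactors_le 0 1 (fun p q => (card_perm_fixed_pattern_le p q).1) S hS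
  have h23 := sum_mul_fixedFactors_le 2 3 (fun p q => (card_perm_fixed_pattern_le p q).2) S hS
  have hle : ∑ π : Fin K → Equiv.Perm (Fin 4), ∏ q, √(S (fixedFactors π q)) ≤
      ∑ π : Fin K → Equiv.Perm (Fin 4), (S (fixedFactors π 0) * S (fixedFactors π 1) +
        S (fixedFactors π 2) * S (fixedFactors π 3)) / 2 := by
    refine sum_le_sum fun π _ => ?_
    rw [Fin.prod_univ_four]
    have h := two_mul_le_add_sq (√(S (fixedFactors π 0)) * √(S (fixedFactors π 1)))
      (√(S (fixedFactors π 2)) * √(S (fixedFactors π 3)))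
    simp only [mul_pow, Real.sq_sqrt (hS _)] at h
    linarith
  rw [← sum_div, sum_add_distrib] at hle
  linarith

end Counting

/-! ### Reality of the trace and conclusion -/

theorem star_sum_prod_perm {t K : ℕ} {ι : Fin K → Type*} [∀ j, Fintype (ι j)]
    {Δ : Matrix (∀ j, ι j) (∀ j, ι j) ℂ} (hΔ : Δ.IsHermitian)
    (π : Fin K → Equiv.Perm (Fin t)) :
    star (∑ x : Fin t → ∀ j, ι j, ∏ q, Δ (x q) fun j => x ((π j)⁻¹ q) j) =
      ∑ x : Fin t → ∀ j, ι j, ∏ q, Δ (x q) fun j => x ((π⁻¹ j)⁻¹ q) j := by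
  let e : (Fin t → ∀ j, ι j) ≃ (Fin t → ∀ j, ι j) :=
    { toFun x q j := x (π j q) j
      invFun x q j := x ((π j)⁻¹ q) j
      left_inv x := by simp
      right_inv x := by simp }
  rw [← e.sum_comp, star_sum]
  refine Finset.sum_congr rfl fun x _ => ?_
  rw [star_prod]
  refine Finset.prod_congr rfl fun q _ => ?_
  rw [hΔ.apply]
  simp [e]

theorem mainTheorem2 (K : ℕ) (ι : Fin K → Type*) [∀ j, Fintype (ι j)] [∀ j, DecidableEq (ι j)]
    (Δ : Matrix (∀ j, ι j) (∀ j, ι j) ℂ) (hΔ : Δ.IsHermitian) :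
    (tensorPow 4 Δ * ∑ π : Fin K → Equiv.Perm (Fin 4), multiPermOp π).trace ≤
      18 ^ K * (∑ I : Finset (Fin K), (partialTrace I Δ ^ 2).trace) ^ 2 := by
  simp only [trace_partialTrace_sq _ hΔ, Finset.mul_sum, Matrix.trace_sum,
    trace_tensorPow_mul_multiPermOp]
  set T : (Fin K → Equiv.Perm (Fin 4)) → ℂ := fun π =>
    ∑ x : Fin 4 → ∀ j, ι j, ∏ q, Δ (x q) fun j => x ((π j)⁻¹ q) j with hT
  -- The order on `ℂ` forces equal imaginary parts. Conjugation sends `T π` to `T π⁻¹`, so the full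
  -- sum is real.
  have hreal : (starRingEnd ℂ) (∑ π, T π) = ∑ π, T π := by
    rw [map_sum, ← Equiv.sum_comp (Equiv.inv (Fin K → Equiv.Perm (Fin 4))) T]
    exact Finset.sum_congr rfl fun π _ => star_sum_prod_perm hΔ π
  obtain ⟨r, hr⟩ := Complex.conj_eq_iff_real.1 hreal
  have hnorm : ‖∑ π, T π‖ ≤ 14 ^ K * (∑ I, partialTraceNormSq I Δ) ^ 2 :=
    (norm_sum_le_of_le _ fun π _ => norm_sum_prod_le Δ π).trans
      (sum_prod_sqrt_fixedFactors_le (fun I => partialTraceNormSq I Δ)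
        fun I => partialTraceNormSq_nonneg I Δ)
  have hr' : r ≤ 18 ^ K * (∑ I, partialTraceNormSq I Δ) ^ 2 := by
    rw [hr, Complex.norm_real] at hnorm
    refine (le_abs_self r).trans (hnorm.trans ?_)
    gcongr
    norm_num
  rw [hr]
  exact_mod_cast hr'
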